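/- Let $n\ge 4$ be an integer and, for $t\in\mathbb C$, let $f_t(z,w)=z^n+t z^{n-1}w+w^n$. For each $t$ such that the binary form $f_t$ is square-free (that is, has no repeated linear factor), let $\mathcal V_t$ be the germ at the origin of the plane curve $\{f_t=0\}\subset\mathbb C^2$. Two plane curve germs $\mathcal V_1,\mathcal V_2$ at the origin of $\mathbb C^2$ are called biholomorphically equivalent if there are a biholomorphic map $F:U_1\to U_2$ between (connected) open neighbourhoods of the origin in $\mathbb C^2$ with $F(0)=0$ and plane curves $V_1\subset U_1$, $V_2\subset U_2$ (zero sets of holomorphic functions on $U_1$, $U_2$ that are not identically zero) representing $\mathcal V_1$, $\mathcal V_2$, such that $F(V_1)=V_2$. Let $t_1,t_2\in\mathbb C$ be such that $f_{t_1}$ and $f_{t_2}$ are square-free. Then $\mathcal V_{t_1}$ and $\mathcal V_{t_2}$ are biholomorphically equivalent if and only if $t_1^n=t_2^n$. -/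

import Mathlib

open Topology

/-- The complex plane `ℂ²`; the coordinates of a point `p` are `z = p 0` and `w = p 1`. -/
abbrev C2 : Type := Fin 2 → ℂ

/-- Germs at the origin of subsets of `ℂ²`: subsets (as predicates) up to equality near `0`. -/
abbrev SetGerm : Type := Filter.Germ (𝓝 (0 : C2)) Prop

/-- The germ at the origin of the subset `V` of `ℂ²`. -/
noncomputable def germAtZero (V : Set C2) : SetGerm := ((fun p : C2 => p ∈ V) : C2 → Prop)

/-- `V` is a plane curve in the domain `U ⊆ ℂ²`: the zero set in `U` of a function that is
holomorphic in `U` and not identically zero there. -/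
def IsPlaneCurveIn (V U : Set C2) : Prop :=
  IsOpen U ∧ IsConnected U ∧
    ∃ f : C2 → ℂ, DifferentiableOn ℂ f U ∧ (∃ p ∈ U, f p ≠ 0) ∧ V = {p ∈ U | f p = 0}

/-- Biholomorphic equivalence of plane curve germs at the origin: there is a biholomorphic map `F`
from a neighbourhood `F.source` of `0` onto a neighbourhood `F.target` of `0`, with `F 0 = 0`,
that maps a plane curve representing the first germ onto a plane curve representing the second. -/
def BiholomorphicallyEquivalent (𝒱₁ 𝒱₂ : SetGerm) : Prop :=
  ∃ F : OpenPartialHomeomorph C2 C2,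
    (0 : C2) ∈ F.source ∧ F 0 = 0 ∧
    DifferentiableOn ℂ F F.source ∧ DifferentiableOn ℂ F.symm F.target ∧
    ∃ V₁ V₂ : Set C2,
      IsPlaneCurveIn V₁ F.source ∧ IsPlaneCurveIn V₂ F.target ∧
      germAtZero V₁ = 𝒱₁ ∧ germAtZero V₂ = 𝒱₂ ∧ F '' V₁ = V₂

/-- The binary form `f_t = z ^ n + t z ^ (n - 1) w + w ^ n`, with `z = X 0` and `w = X 1`. -/
noncomputable def familyForm (n : ℕ) (t : ℂ) : MvPolynomial (Fin 2) ℂ :=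
  MvPolynomial.X 0 ^ n
    + MvPolynomial.C t * MvPolynomial.X 0 ^ (n - 1) * MvPolynomial.X 1
    + MvPolynomial.X 1 ^ n

/-- The germ at the origin of the curve `f_t = 0` in `ℂ²`. -/
noncomputable def curveGerm (n : ℕ) (t : ℂ) : SetGerm :=
  germAtZero {p : C2 | MvPolynomial.eval p (familyForm n t) = 0}

open MvPolynomial

/-! Both curves are unions of lines through 0, so the differential `A` at 0 of an equivalence, which
is invertible, maps the first curve into the second (`eval_familyForm_fderiv_eq_zero`). By the
Nullstellensatz and square-freeness, f_{t₂} ∘ A = k f_{t₁} with k ≠ 0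
(`exists_eq_C_mul_of_forall_eval_eq_zero`).

The rest is algebra (`pow_eq_pow_of_substForm_eq`). For n ≥ 5 a third order operator built from `A`
kills f_{t₂} ∘ A, hence f_{t₁}; if t₁ ≠ 0 this makes `A` diagonal, and coefficients can be compared.
For n = 4 the invariants I and J of binary quartics decide.

Conversely, t₁ = ζ t₂ with ζ^n = 1, and (z, w) ↦ (z, ζw) is an equivalence. -/

/-- The value of the binary form at the point `(z, w)`. -/
theorem eval_familyForm (n : ℕ) (t : ℂ) (p : C2) :
    eval p (familyForm n t) = p 0 ^ n + t * p 0 ^ (n - 1) * p 1 + p 1 ^ n := by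
  simp [familyForm]

theorem eval_familyForm_smul {n : ℕ} (hn : 1 ≤ n) (t : ℂ) (r : ℂ) (p : C2) :
    eval (r • p) (familyForm n t) = r ^ n * eval p (familyForm n t) := by
  obtain ⟨m, rfl⟩ : ∃ m, n = m + 1 := ⟨n - 1, by omega⟩
  simp only [eval_familyForm, Pi.smul_apply, smul_eq_mul, Nat.add_sub_cancel]
  ring

theorem eval_familyForm_one_zero {n : ℕ} (hn : 1 ≤ n) (t : ℂ) :
    eval ![1, 0] (familyForm n t) = 1 := by
  have : n ≠ 0 := by omega
  simp [eval_familyForm, this]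

theorem isHomogeneous_familyForm {n : ℕ} (hn : 1 ≤ n) (t : ℂ) :
    (familyForm n t).IsHomogeneous n := by
  refine ((isHomogeneous_X_pow _ _).add ?_).add (isHomogeneous_X_pow _ _)
  have := ((isHomogeneous_C (Fin 2) t).mul
    (isHomogeneous_X_pow (R := ℂ) (0 : Fin 2) (n - 1))).mul (isHomogeneous_X ℂ (1 : Fin 2))
  rwa [show 0 + (n - 1) + 1 = n by omega] at this

/-- A form of degree `n` vanishing on the zero set of a square-free form of the same degree is a
constant multiple of it. -/
theorem exists_eq_C_mul_of_forall_eval_eq_zero {σ : Type*} [Finite σ] {n : ℕ}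
    {f g : MvPolynomial σ ℂ} (hf : Squarefree f) (hfn : f.IsHomogeneous n)
    (hgn : g.IsHomogeneous n) (h : ∀ p : σ → ℂ, eval p f = 0 → eval p g = 0) :
    ∃ k : ℂ, g = C k * f := by
  have hf0 : f ≠ 0 := hf.ne_zero
  have hmem : g ∈ vanishingIdeal ℂ (zeroLocus ℂ (Ideal.span {f})) := by
    intro p hp
    have := h p (by simpa [aeval_eq_eval] using hp f (Ideal.subset_span rfl))
    simpa [aeval_eq_eval] using this
  -- Some power of `g` lies in (f), and a square-free `f` generates a radical ideal, so f ∣ g; equal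
  -- degrees make the cofactor constant.
  rw [vanishingIdeal_zeroLocus_eq_radical] at hmem
  obtain ⟨m, hm⟩ := hmem
  rw [Ideal.mem_span_singleton] at hm
  obtain ⟨q, rfl⟩ := hf.isRadical m g hm
  rcases eq_or_ne q 0 with rfl | hq
  · exact ⟨0, by simp⟩
  have hd := totalDegree_mul_of_isDomain hf0 hq
  rw [hfn.totalDegree hf0, hgn.totalDegree (mul_ne_zero hf0 hq)] at hd
  have hq0 : q.totalDegree = 0 := by omega
  refine ⟨coeff 0 q, ?_⟩
  rw [← totalDegree_eq_zero_iff_eq_C.mp hq0, mul_comm]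

/-! ### Linear substitutions within the family -/

/-- The binary form `f_t` after the linear substitution `(z, w) ↦ (a z + b w, c z + d w)`. -/
noncomputable def substForm (n : ℕ) (t a b c d : ℂ) : MvPolynomial (Fin 2) ℂ :=
  (C a * X 0 + C b * X 1) ^ n
    + C t * (C a * X 0 + C b * X 1) ^ (n - 1) * (C c * X 0 + C d * X 1)
    + (C c * X 0 + C d * X 1) ^ n

theorem eval_substForm (n : ℕ) (t a b c d : ℂ) (p : C2) :
    eval p (substForm n t a b c d) =
      eval ![a * p 0 + b * p 1, c * p 0 + d * p 1] (familyForm n t) := by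
  simp [substForm, familyForm]

theorem isHomogeneous_substForm {n : ℕ} (hn : 1 ≤ n) (t a b c d : ℂ) :
    (substForm n t a b c d).IsHomogeneous n := by
  have hl (x y : ℂ) : (C x * X 0 + C y * X 1 : MvPolynomial (Fin 2) ℂ).IsHomogeneous 1 :=
    (isHomogeneous_C_mul_X _ _).add (isHomogeneous_C_mul_X _ _)
  have hp (x y : ℂ) (m : ℕ) :
      ((C x * X 0 + C y * X 1 : MvPolynomial (Fin 2) ℂ) ^ m).IsHomogeneous m := by
    simpa using (hl x y).pow m
  refine ((hp _ _ _).add ?_).add (hp _ _ _)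
  have := ((isHomogeneous_C (Fin 2) t).mul (hp a b (n - 1))).mul (hl c d)
  rwa [show 0 + (n - 1) + 1 = n by omega] at this

/-- Differentiation in the direction `(x, y)`. -/
noncomputable def dirDeriv (x y : ℂ) :
    Derivation ℂ (MvPolynomial (Fin 2) ℂ) (MvPolynomial (Fin 2) ℂ) :=
  x • pderiv 0 + y • pderiv 1

theorem dirDeriv_X_zero (x y : ℂ) : dirDeriv x y (X 0) = C x := by
  simp [dirDeriv, smul_eq_C_mul]

theorem dirDeriv_X_one (x y : ℂ) : dirDeriv x y (X 1) = C y := by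
  simp [dirDeriv, smul_eq_C_mul]

theorem dirDeriv_C (x y r : ℂ) : dirDeriv x y (C r) = 0 := by
  simp [dirDeriv]

theorem dirDeriv_linear (x y a b : ℂ) :
    dirDeriv x y (C a * X 0 + C b * X 1) = C (a * x + b * y) := by
  simp [Derivation.leibniz, dirDeriv_X_zero, dirDeriv_X_one]

/-- A third order operator annihilating `substForm n t a b c d`. -/
theorem dirDeriv_substForm (m : ℕ) (t a b c d : ℂ) :
    dirDeriv d (-c) (dirDeriv b (-a) (dirDeriv b (-a) (substForm (m + 2) t a b c d))) = 0 := by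
  -- Write L = az + bw, M = cz + dw. Two derivatives along (b, -a) kill L^n and L^(n-1) M and turn
  -- M^n into a multiple of M^(n-2), which the derivative along (d, -c) kills.
  have hL : dirDeriv b (-a) (C a * X 0 + C b * X 1) = 0 := by
    rw [dirDeriv_linear, show a * b + b * -a = 0 by ring, C_0]
  have hM : dirDeriv d (-c) (C c * X 0 + C d * X 1) = 0 := by
    rw [dirDeriv_linear, show c * d + d * -c = 0 by ring, C_0]
  have hM' : dirDeriv b (-a) (C c * X 0 + C d * X 1) = C (c * b + d * -a) := dirDeriv_linear _ _ _ _
  rw [substForm]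
  generalize (C a * X 0 + C b * X 1 : MvPolynomial (Fin 2) ℂ) = L at *
  generalize (C c * X 0 + C d * X 1 : MvPolynomial (Fin 2) ℂ) = M at *
  generalize c * b + d * -a = e at *
  simp only [map_add, Derivation.leibniz, Derivation.leibniz_pow, hL, hM, hM', dirDeriv_C,
    smul_zero, zero_add, add_zero, smul_eq_mul, mul_zero, map_nsmul]

theorem eval_dirDeriv_familyForm (m : ℕ) (t x y u v : ℂ) (p : C2) :
    eval p (dirDeriv x y (dirDeriv u v (dirDeriv u v (familyForm (m + 4) t)))) =
      x * u ^ 2 * ((m + 4) * (m + 3) * (m + 2) * p 0 ^ (m + 1)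
          + t * (m + 3) * (m + 2) * (m + 1) * p 0 ^ m * p 1)
        + (2 * x * u * v + y * u ^ 2) * (t * (m + 3) * (m + 2) * p 0 ^ (m + 1))
        + y * v ^ 2 * ((m + 4) * (m + 3) * (m + 2) * p 1 ^ (m + 1)) := by
  simp only [familyForm, map_add, Derivation.leibniz, Derivation.leibniz_pow, dirDeriv_C,
    dirDeriv_X_zero, dirDeriv_X_one, zero_add, add_zero, smul_eq_mul, mul_zero,
    Derivation.map_natCast, map_mul, eval_C, eval_X, map_pow, nsmul_eq_mul, map_natCast,
    Nat.add_sub_cancel, show m + 4 - 1 = m + 3 by omega, show m + 3 - 1 = m + 2 by omega,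
    show m + 2 - 1 = m + 1 by omega]
  push_cast
  ring

/-- For `n ≥ 5` a linear substitution between members of the family is diagonal. -/
theorem diagonal_of_substForm_eq {n : ℕ} (hn : 5 ≤ n) {s t a b c d k : ℂ}
    (hdet : a * d - b * c ≠ 0) (hk : k ≠ 0) (ht : t ≠ 0)
    (h : substForm n s a b c d = C k * familyForm n t) : b = 0 ∧ c = 0 := by
  -- The monomials z^(n-4) w and w^(n-3) are distinct only for n ≥ 5; this is why quartics are
  -- treated apart.
  obtain ⟨m, rfl⟩ : ∃ m, n = m + 1 + 4 := ⟨n - 5, by omega⟩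
  have hD := dirDeriv_substForm (m + 3) s a b c d
  rw [show m + 3 + 2 = m + 1 + 4 by omega, h] at hD
  simp only [Derivation.leibniz, dirDeriv_C, add_zero, smul_eq_mul, mul_zero, mul_eq_zero,
    C_eq_zero, hk, false_or] at hD
  have hev (z w : ℂ) := (eval_dirDeriv_familyForm (m + 1) t d (-c) b (-a) ![z, w]).symm
  simp only [hD, map_zero, Matrix.cons_val_zero, Matrix.cons_val_one] at hev
  have e5 : ((m : ℂ) + 1 + 4) ≠ 0 := by exact_mod_cast (by omega : m + 1 + 4 ≠ 0)
  have e4 : ((m : ℂ) + 1 + 3) ≠ 0 := by exact_mod_cast (by omega : m + 1 + 3 ≠ 0)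
  have e3 : ((m : ℂ) + 1 + 2) ≠ 0 := by exact_mod_cast (by omega : m + 1 + 2 ≠ 0)
  have e2 : ((m : ℂ) + 1 + 1) ≠ 0 := by exact_mod_cast (by omega : m + 1 + 1 ≠ 0)
  have h01 := hev 0 1
  have h10 := hev 1 0
  have h11 := hev 1 1
  push_cast at h01 h10 h11
  have p3 : c * a ^ 2 = 0 := by simpa [e5, e4, e3] using h01
  have p0 : d * b ^ 2 = 0 := by
    have : d * b ^ 2 * (t * ((m : ℂ) + 1 + 3) * (m + 1 + 2) * (m + 1 + 1)) = 0 := by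
      simp at h10 h11
      linear_combination h11 - h10 + p3 * (((m : ℂ) + 1 + 4) * (m + 1 + 3) * (m + 1 + 2))
    simpa [e4, e3, e2, ht] using this
  have p1 : 2 * d * b * a + c * b ^ 2 = 0 := by
    have : (2 * d * b * a + c * b ^ 2) * (t * ((m : ℂ) + 1 + 3) * (m + 1 + 2)) = 0 := by
      simp at h10
      linear_combination -h10 + p0 * (((m : ℂ) + 1 + 4) * (m + 1 + 3) * (m + 1 + 2))
    simpa [e4, e3, ht] using this
  have hb : b = 0 := by
    by_contra hb
    have hd : d = 0 := by simpa [hb] using p0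
    have hc : c = 0 := by simpa [hb, hd] using p1
    simp [hd, hc] at hdet
  refine ⟨hb, ?_⟩
  have ha : a ≠ 0 := by rintro rfl; simp [hb] at hdet
  simpa [ha] using p3

/-- A diagonal substitution gives a^n = d^n = k and s a^(n-1) d = k t; take n-th powers of the last
relation. -/
theorem pow_eq_pow_of_substForm_eq_of_five_le {n : ℕ} (hn : 5 ≤ n) {s t a b c d k : ℂ}
    (hdet : a * d - b * c ≠ 0) (hk : k ≠ 0) (ht : t ≠ 0)
    (h : substForm n s a b c d = C k * familyForm n t) : s ^ n = t ^ n := by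
  obtain ⟨rfl, rfl⟩ := diagonal_of_substForm_eq hn hdet hk ht h
  have hev (z w : ℂ) := congrArg (eval ![z, w]) h
  simp only [eval_substForm, eval_familyForm, map_mul, eval_C, Matrix.cons_val_zero,
    Matrix.cons_val_one] at hev
  obtain ⟨m, rfl⟩ : ∃ m, n = m + 1 := ⟨n - 1, by omega⟩
  have h10 : a ^ (m + 1) = k := by simpa using hev 1 0
  have h01 : d ^ (m + 1) = k := by
    simpa [show m ≠ 0 by omega] using hev 0 1
  have h11 : s * a ^ m * d = k * t := by
    have := hev 1 1
    simp [h10, h01] at this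
    linear_combination this
  have : k ^ (m + 1) * s ^ (m + 1) = k ^ (m + 1) * t ^ (m + 1) := by
    calc k ^ (m + 1) * s ^ (m + 1) = (a ^ (m + 1)) ^ m * d ^ (m + 1) * s ^ (m + 1) := by
          rw [h10, h01]; ring
      _ = (s * a ^ m * d) ^ (m + 1) := by ring
      _ = _ := by rw [h11]; ring
  exact mul_left_cancel₀ (pow_ne_zero _ hk) this

/-- For quartics the claim follows from the two classical invariants of binary quartics. -/
theorem pow_eq_pow_of_substForm_four_eq {s t a b c d k : ℂ} (hk : k ≠ 0)
    (h : substForm 4 s a b c d = C k * familyForm 4 t) : s ^ 4 = t ^ 4 := by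
  have hev (z w : ℂ) := congrArg (eval ![z, w]) h
  simp only [eval_substForm, eval_familyForm, map_mul, eval_C, Matrix.cons_val_zero,
    Matrix.cons_val_one, show 4 - 1 = 3 by norm_num] at hev
  obtain ⟨g0, hg0⟩ : ∃ g, g = a ^ 4 + s * a ^ 3 * c + c ^ 4 := ⟨_, rfl⟩
  obtain ⟨g1, hg1⟩ : ∃ g, g = 4 * a ^ 3 * b + s * (3 * a ^ 2 * b * c + a ^ 3 * d)
    + 4 * c ^ 3 * d := ⟨_, rfl⟩
  obtain ⟨g2, hg2⟩ : ∃ g, g = 6 * a ^ 2 * b ^ 2 + s * (3 * a * b ^ 2 * c + 3 * a ^ 2 * b * d)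
    + 6 * c ^ 2 * d ^ 2 := ⟨_, rfl⟩
  obtain ⟨g3, hg3⟩ : ∃ g, g = 4 * a * b ^ 3 + s * (b ^ 3 * c + 3 * a * b ^ 2 * d)
    + 4 * c * d ^ 3 := ⟨_, rfl⟩
  obtain ⟨g4, hg4⟩ : ∃ g, g = b ^ 4 + s * b ^ 3 * d + d ^ 4 := ⟨_, rfl⟩
  -- I and J have weights 4 and 6, and take the values 12 and -27 s² on f_s.
  have hI : 12 * (a * d - b * c) ^ 4 = 12 * g0 * g4 - 3 * g1 * g3 + g2 ^ 2 := by
    rw [hg0, hg1, hg2, hg3, hg4]; ring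
  have hJ : -27 * s ^ 2 * (a * d - b * c) ^ 6 = 72 * g0 * g2 * g4 + 9 * g1 * g2 * g3
      - 27 * g0 * g3 ^ 2 - 27 * g1 ^ 2 * g4 - 2 * g2 ^ 3 := by
    rw [hg0, hg1, hg2, hg3, hg4]; ring
  have hpoly (z w : ℂ) : g0 * z ^ 4 + g1 * z ^ 3 * w + g2 * z ^ 2 * w ^ 2 + g3 * z * w ^ 3
      + g4 * w ^ 4 = k * (z ^ 4 + t * z ^ 3 * w + w ^ 4) := by
    rw [← hev z w, hg0, hg1, hg2, hg3, hg4]; ring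
  clear hg0 hg1 hg2 hg3 hg4 hev h
  have e0 : g0 = k := by linear_combination hpoly 1 0
  have e4 : g4 = k := by linear_combination hpoly 0 1
  have e2 : g2 = 0 := by linear_combination (hpoly 1 1 + hpoly 1 (-1)) / 2 - e0 - e4
  have e13 : g1 + g3 = k * t := by linear_combination (hpoly 1 1 - hpoly 1 (-1)) / 2
  have e3 : g3 = 0 := by
    linear_combination (hpoly 1 2 - e0 - 4 * e2 - 16 * e4 - 2 * e13) / 6
  have e1 : g1 = k * t := by linear_combination e13 - e3
  rw [e0, e1, e2, e3, e4] at hI hJ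
  generalize a * d - b * c = D at hI hJ
  have hI' : D ^ 4 = k ^ 2 := by linear_combination hI / 12
  have hJ' : s ^ 2 * D ^ 6 = k ^ 3 * t ^ 2 := by linear_combination -hJ / 27
  have : k ^ 6 * s ^ 4 = k ^ 6 * t ^ 4 := by
    calc k ^ 6 * s ^ 4 = (k ^ 2) ^ 3 * s ^ 4 := by ring
      _ = (s ^ 2 * D ^ 6) ^ 2 := by rw [← hI']; ring
      _ = _ := by rw [hJ']; ring
  exact mul_left_cancel₀ (pow_ne_zero _ hk) this

/-- The inverse of a linear substitution. -/
theorem substForm_inv {n : ℕ} {s t a b c d k : ℂ}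
    (hdet : a * d - b * c ≠ 0) (hk : k ≠ 0)
    (h : substForm n s a b c d = C k * familyForm n t) :
    substForm n t (d / (a * d - b * c)) (-b / (a * d - b * c)) (-c / (a * d - b * c))
      (a / (a * d - b * c)) = C k⁻¹ * familyForm n s := by
  refine MvPolynomial.funext fun p => ?_
  have := congrArg (eval ![d / (a * d - b * c) * p 0 + -b / (a * d - b * c) * p 1,
    -c / (a * d - b * c) * p 0 + a / (a * d - b * c) * p 1]) h
  rw [eval_mul, eval_C] at this ⊢
  rw [eval_substForm, eq_inv_mul_iff_mul_eq₀ hk, ← this, eval_substForm]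
  congr 2
  ext i
  fin_cases i
  all_goals
    obtain ⟨D, hD⟩ : ∃ D, D = a * d - b * c := ⟨_, rfl⟩
    rw [← hD] at hdet
    simp only [← hD, Fin.zero_eta, Fin.mk_one, Matrix.cons_val_zero, Matrix.cons_val_one]
    field_simp
    rw [hD]
    ring

theorem pow_eq_pow_of_substForm_eq {n : ℕ} (hn : 4 ≤ n) {s t a b c d k : ℂ}
    (hdet : a * d - b * c ≠ 0) (hk : k ≠ 0)
    (h : substForm n s a b c d = C k * familyForm n t) : s ^ n = t ^ n := by
  rcases hn.eq_or_lt with rfl | hn5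
  · exact pow_eq_pow_of_substForm_four_eq hk h
  rcases ne_or_eq t 0 with ht | rfl
  · exact pow_eq_pow_of_substForm_eq_of_five_le hn5 hdet hk ht h
  -- z^n + w^n admits the swap of z and w, so diagonality can fail for t = 0; the inverse
  -- substitution exchanges the roles of `s` and `t`.
  rcases ne_or_eq s 0 with hs | rfl
  · refine (pow_eq_pow_of_substForm_eq_of_five_le hn5 ?_ (inv_ne_zero hk) hs
      (substForm_inv hdet hk h)).symm
    have : d / (a * d - b * c) * (a / (a * d - b * c))
        - -b / (a * d - b * c) * (-c / (a * d - b * c)) = (a * d - b * c)⁻¹ := by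
      field_simp
    rw [this]
    exact inv_ne_zero hdet
  · rfl

/-! ### From biholomorphisms to their differentials -/

open Filter in
/-- If a map differentiable at `0` sends the germ of one curve of the family into another, then its
differential sends the first curve into the second. -/
theorem eval_familyForm_fderiv_eq_zero {n : ℕ} (hn : 1 ≤ n) {s t : ℂ} {F : C2 → C2}
    {A : C2 →L[ℂ] C2} (hF : HasFDerivAt F A 0) (hF0 : F 0 = 0)
    (hV : ∀ᶠ p in 𝓝 (0 : C2), eval p (familyForm n t) = 0 → eval (F p) (familyForm n s) = 0)
    {p : C2} (hp : eval p (familyForm n t) = 0) : eval (A p) (familyForm n s) = 0 := by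
  have hline : HasDerivAt (fun r : ℂ => F (r • p)) (A p) 0 := by
    have hg : HasDerivAt (fun r : ℂ => r • p) p 0 := by
      simpa using (hasDerivAt_id (0 : ℂ)).smul_const p
    exact HasFDerivAt.comp_hasDerivAt (0 : ℂ) (by simpa using hF) hg
  have hlim := hline.tendsto_slope_zero
  simp only [zero_add, zero_smul, hF0, sub_zero] at hlim
  have hcont : Continuous fun q : C2 => eval q (familyForm n s) := by
    simp only [eval_familyForm]
    fun_prop
  have hlim' := (hcont.tendsto (A p)).comp hlim
  refine tendsto_nhds_unique hlim' (tendsto_const_nhds.congr' ?_)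
  have hsm : Tendsto (fun r : ℂ => r • p) (𝓝[≠] 0) (𝓝 0) := by
    have : Continuous fun r : ℂ => r • p := by fun_prop
    simpa using (this.tendsto 0).mono_left nhdsWithin_le_nhds
  -- A p is the limit of r⁻¹ F(rp), and by homogeneity f_s vanishes at these points for small r ≠ 0.
  filter_upwards [hsm.eventually hV] with r hr
  have : eval (r • p) (familyForm n t) = 0 := by
    rw [eval_familyForm_smul hn, hp, mul_zero]
  simp [eval_familyForm_smul hn, hr this]

theorem germAtZero_eq_iff {V W : Set C2} :
    germAtZero V = germAtZero W ↔ ∀ᶠ p in 𝓝 (0 : C2), p ∈ V ↔ p ∈ W := by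
  simp only [germAtZero, Filter.Germ.coe_eq, Filter.EventuallyEq, eq_iff_iff]

theorem apply_eq_of_basis (A : C2 →L[ℂ] C2) (p : C2) :
    A p = ![A ![1, 0] 0 * p 0 + A ![0, 1] 0 * p 1, A ![1, 0] 1 * p 0 + A ![0, 1] 1 * p 1] := by
  have hp : p = p 0 • ![1, 0] + p 1 • ![0, 1] := by
    ext i; fin_cases i <;> simp
  have hA : A p = p 0 • A ![1, 0] + p 1 • A ![0, 1] := by
    conv_lhs => rw [hp]
    rw [map_add, map_smul, map_smul]
  rw [hA]
  ext i; fin_cases i <;> simp [mul_comm]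

/-- A surjective linear map of the plane has nonzero determinant. -/
theorem det_ne_zero_of_surjective {A : C2 →L[ℂ] C2} (hA : Function.Surjective A) :
    A ![1, 0] 0 * A ![0, 1] 1 - A ![0, 1] 0 * A ![1, 0] 1 ≠ 0 := by
  intro h
  obtain ⟨p, hp⟩ := hA ![1, 0]
  obtain ⟨q, hq⟩ := hA ![0, 1]
  rw [apply_eq_of_basis] at hp hq
  have p0 := congrFun hp 0
  have p1 := congrFun hp 1
  have q0 := congrFun hq 0
  have q1 := congrFun hq 1
  simp only [Matrix.cons_val_zero, Matrix.cons_val_one] at p0 p1 q0 q1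
  have : (1 : ℂ) = 0 := by
    generalize A ![1, 0] 0 = a at *
    generalize A ![1, 0] 1 = c at *
    generalize A ![0, 1] 0 = b at *
    generalize A ![0, 1] 1 = d at *
    linear_combination (p 0 * q 1 - p 1 * q 0) * h - q1 * (a * p 0 + b * p 1) - p0
      + q0 * (c * p 0 + d * p 1)
  exact one_ne_zero this

theorem pow_eq_pow_of_biholomorphicallyEquivalent {n : ℕ} (hn : 4 ≤ n) {t₁ t₂ : ℂ}
    (h₁ : Squarefree (familyForm n t₁))
    (h : BiholomorphicallyEquivalent (curveGerm n t₁) (curveGerm n t₂)) : t₁ ^ n = t₂ ^ n := by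
  obtain ⟨F, h0, hF0, hF, hG, V₁, V₂, -, -, hV₁, hV₂, hV⟩ := h
  have hn1 : 1 ≤ n := by omega
  have h0t : (0 : C2) ∈ F.target := hF0 ▸ F.map_source h0
  have hFd : HasFDerivAt F (fderiv ℂ F 0) 0 :=
    (hF.differentiableAt (F.open_source.mem_nhds h0)).hasFDerivAt
  have hGd : HasFDerivAt F.symm (fderiv ℂ F.symm 0) 0 :=
    (hG.differentiableAt (F.open_target.mem_nhds h0t)).hasFDerivAt
  have hG0 : F.symm 0 = 0 := by simpa [hF0] using F.left_inv h0
  set A := fderiv ℂ F 0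
  have hsurj : Function.Surjective A := by
    have hcomp : HasFDerivAt (F ∘ F.symm) (A.comp (fderiv ℂ F.symm 0)) 0 :=
      HasFDerivAt.comp (0 : C2) (by rwa [hG0]) hGd
    have hid : HasFDerivAt (F ∘ F.symm) (ContinuousLinearMap.id ℂ C2) 0 := by
      refine (hasFDerivAt_id (0 : C2)).congr_of_eventuallyEq ?_
      filter_upwards [F.open_target.mem_nhds h0t] with q hq using F.right_inv hq
    have := hcomp.unique hid
    exact fun q => ⟨fderiv ℂ F.symm 0 q, by simpa using DFunLike.congr_fun this q⟩
  have hmaps : ∀ᶠ p in 𝓝 (0 : C2),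
      eval p (familyForm n t₁) = 0 → eval (F p) (familyForm n t₂) = 0 := by
    have hc : Filter.Tendsto F (𝓝 0) (𝓝 0) := by
      simpa [ContinuousAt, hF0] using hFd.continuousAt
    filter_upwards [germAtZero_eq_iff.mp hV₁, hc.eventually (germAtZero_eq_iff.mp hV₂)]
      with p hp₁ hp₂ hp
    exact hp₂.mp (hV ▸ Set.mem_image_of_mem F (hp₁.mpr hp))
  have hdet := det_ne_zero_of_surjective hsurj
  have hev (p : C2) : eval p (substForm n t₂ (A ![1, 0] 0) (A ![0, 1] 0) (A ![1, 0] 1)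
      (A ![0, 1] 1)) = eval (A p) (familyForm n t₂) := by
    rw [eval_substForm, ← apply_eq_of_basis]
  obtain ⟨k, hk⟩ := exists_eq_C_mul_of_forall_eval_eq_zero h₁ (isHomogeneous_familyForm hn1 t₁)
    (isHomogeneous_substForm hn1 t₂ (A ![1, 0] 0) (A ![0, 1] 0) (A ![1, 0] 1) (A ![0, 1] 1))
    fun p hp => by
      rw [hev]
      exact eval_familyForm_fderiv_eq_zero hn1 hFd hF0 hmaps hp
  have hk0 : k ≠ 0 := by
    rintro rfl
    -- f_{t₂} ∘ A is not zero, since f_{t₂}(1, 0) = 1 and (1, 0) is in the range of `A`.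
    obtain ⟨p, hp⟩ := hsurj ![1, 0]
    have := hev p
    rw [hp, eval_familyForm_one_zero hn1, hk] at this
    simp at this
  exact (pow_eq_pow_of_substForm_eq hn hdet hk0 hk).symm

/-! ### The converse: diagonal equivalences -/

theorem isPlaneCurveIn_univ_familyForm {n : ℕ} (hn : 1 ≤ n) (t : ℂ) :
    IsPlaneCurveIn {p | eval p (familyForm n t) = 0} Set.univ := by
  refine ⟨isOpen_univ, isConnected_univ, fun p => eval p (familyForm n t), ?_,
    ⟨![1, 0], trivial, by simp [eval_familyForm_one_zero hn]⟩, by simp⟩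
  simp only [eval_familyForm]
  fun_prop

theorem biholomorphicallyEquivalent_of_pow_eq_pow {n : ℕ} (hn : 1 ≤ n) {t₁ t₂ : ℂ}
    (h : t₁ ^ n = t₂ ^ n) :
    BiholomorphicallyEquivalent (curveGerm n t₁) (curveGerm n t₂) := by
  have hn0 : n ≠ 0 := by omega
  obtain ⟨ζ, hζ, hζt⟩ : ∃ ζ : ℂ, ζ ^ n = 1 ∧ t₁ = ζ * t₂ := by
    rcases eq_or_ne t₂ 0 with rfl | ht
    · exact ⟨1, by simp, by simpa [hn0] using h⟩
    · exact ⟨t₁ / t₂, by rw [div_pow, h, div_self (pow_ne_zero _ ht)], by field_simp⟩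
  have hζ0 : ζ ≠ 0 := by rintro rfl; simp [hn0] at hζ
  let F : C2 ≃ₜ C2 :=
    { toFun := fun p => ![p 0, ζ * p 1]
      invFun := fun p => ![p 0, ζ⁻¹ * p 1]
      left_inv := fun p => by ext i; fin_cases i <;> simp [hζ0]
      right_inv := fun p => by ext i; fin_cases i <;> simp [hζ0]
      continuous_toFun := by fun_prop
      continuous_invFun := by fun_prop }
  have hd (r : ℂ) : Differentiable ℂ fun p : C2 => (![p 0, r * p 1] : C2) := by
    rw [differentiable_pi]
    intro i
    fin_cases i <;> simp <;> fun_prop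
  have hFev (p : C2) : eval (F p) (familyForm n t₂) = eval p (familyForm n t₁) := by
    have : F p = ![p 0, ζ * p 1] := rfl
    rw [this, eval_familyForm, eval_familyForm, hζt]
    simp [mul_pow, hζ]
    ring
  refine ⟨F.toOpenPartialHomeomorph, trivial, ?_, (hd ζ).differentiableOn,
    (hd ζ⁻¹).differentiableOn, {p | eval p (familyForm n t₁) = 0},
    {p | eval p (familyForm n t₂) = 0}, isPlaneCurveIn_univ_familyForm hn t₁,
    isPlaneCurveIn_univ_familyForm hn t₂, rfl, rfl, ?_⟩
  · ext i; fin_cases i <;> simp [F]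
  · ext q
    constructor
    · rintro ⟨p, hp, rfl⟩
      exact (hFev p).trans hp
    · intro hq
      refine ⟨F.symm q, ?_, F.apply_symm_apply q⟩
      simpa [← hFev] using hq

theorem theorem1p1 (n : ℕ) (hn : 4 ≤ n) (t₁ t₂ : ℂ)
    (h₁ : Squarefree (familyForm n t₁)) (h₂ : Squarefree (familyForm n t₂)) :
    BiholomorphicallyEquivalent (curveGerm n t₁) (curveGerm n t₂) ↔ t₁ ^ n = t₂ ^ n :=
  ⟨pow_eq_pow_of_biholomorphicallyEquivalent hn h₁,
    biholomorphicallyEquivalent_of_pow_eq_pow (by omega)⟩
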